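/- For a finite simple graph $G$ with vertex set $V$, $|V|=d$, let $P(G)=\{x\in[0,1]^V : x_v+x_w\le 1 \text{ for every edge } vw \text{ of } G\}\subset\mathbb{R}^V$ be its graph polytope. For a polytope $S\subset\mathbb{R}^V$ let $L_S(t)=|tS\cap\mathbb{Z}^V|$ for integers $t\ge 1$, and let $\mathrm{Ehr}_S(z)=1+\sum_{t\ge1}L_S(t)z^t$ be its Ehrhart series. The $h^*$-polynomial of $P(G)$ is the polynomial $h\in\mathbb{Z}[z]$ with $$\mathrm{Ehr}_{P(G)}(z)=\frac{h(z)}{(1-z)^{d+1}},$$ which is unique if it exists. A polynomial $p$ of degree $n$ is called palindromic if $z^n p(1/z)=p(z)$. **Theorem.** (a) Let $G$ be a finite simple bipartite graph with $d\ge1$ vertices and without isolated vertices (so that $d\ge2$). Then the $h^*$-polynomial of $P(G)$ exists and is a palindromic polynomial of degree exactly $d-2$. (b) (Conjecture 1 of OEIS A205497.) For every integer $n\ge0$ let $L_n$ be the path graph with vertices $1,\dots,n$ and edges $\{i,i+1\}$, $1\le i\le n-1$. Then the $h^*$-polynomial $h_n$ of $P(L_n)$ exists and is palindromic, of degree $n-2$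 if $n\ge2$ and of degree $0$ if $n\in\{0,1\}$. -/

import Mathlib

/-- The graph polytope `P(G)`: the points of the unit cube, with coordinates indexed by the
vertices of `G`, such that `x v + x w ≤ 1` for every edge `vw` of `G`. -/
def graphPolytope {V : Type*} (G : SimpleGraph V) : Set (V → ℝ) :=
  {x | (∀ v, x v ∈ Set.Icc (0 : ℝ) 1) ∧ ∀ v w, G.Adj v w → x v + x w ≤ 1}

open scoped Pointwise in
/-- The number `L_S(t)` of integer points of the dilate `tS`. (The set counted is finite
when `S` is bounded.) -/
noncomputable def latticeCount {V : Type*} (S : Set (V → ℝ)) (t : ℕ) : ℕ :=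
  {m : V → ℤ | (fun v => (m v : ℝ)) ∈ (t : ℝ) • S}.ncard

/-- The Ehrhart series `1 + ∑_{t ≥ 1} L_S(t) z^t`. -/
noncomputable def ehrhartSeries {V : Type*} (S : Set (V → ℝ)) : PowerSeries ℤ :=
  PowerSeries.mk fun t => if t = 0 then 1 else (latticeCount S t : ℤ)

/-- `h` is the `h*`-polynomial of the full-dimensional polytope `S` in `ℝ^V`, where `V` has `d`
elements: the Ehrhart series of `S` is `h(z) / (1 - z)^(d+1)`. Since `1 - z` is invertible as a
power series, there is at most one such `h`. -/
def IsHStarPolynomial {V : Type*} [Fintype V] (S : Set (V → ℝ)) (h : Polynomial ℤ) : Prop :=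
  (h : PowerSeries ℤ) = ehrhartSeries S * (1 - PowerSeries.X) ^ (Fintype.card V + 1)

/-- `p` has degree exactly `n` and `z^n p(1/z) = p(z)`. -/
def IsPalindromicOfDegree (p : Polynomial ℤ) (n : ℕ) : Prop :=
  p.degree = (n : WithBot ℕ) ∧ Polynomial.reflect n p = p

/-! Replacing `x v` by `t - x v` on one colour class turns the edge inequalities into `x v ≤ x w`,
so the lattice points of the `t`-th dilate are the weakly order-preserving maps from a height-two
relation `R` to a chain of `t + 1` elements. Stanley's theory of P-partitions applies: sorting a map
assigns it to a linear extension `σ` of `R`, each class is counted by a binomial coefficient, and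
the numerator of the Ehrhart series is `h = ∑ X ^ des σ`.

With `d = m + 1`, strict maps have the same series with `h` replaced by its reflection in degree `m`
(`mk_strictCount_mul`). Without isolated vertices every element is a source or a target, and raising
the targets by one matches weak maps with strict maps into a chain one longer (`strictCount_succ`).
Hence `reflect m h = X * h`; as `h` has constant term 1, it is palindromic of degree `m - 1 = d -
2`. -/

/-! ### Counting words with a prescribed sorting permutation -/

/-- The positions `i` at which the word `σ 0, σ 1, …, σ m` descends. -/
def descentSet {m : ℕ} (σ : Fin (m + 1) → Fin (m + 1)) : Finset (Fin m) :=
  Finset.univ.filter fun i => σ i.succ < σ i.castSucc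

/-- The number of positions before `i` that do not lie in `D`. -/
def weakSteps {m : ℕ} (D : Finset (Fin m)) (i : Fin (m + 1)) : ℕ :=
  (Finset.univ.filter fun j : Fin m => j.castSucc < i ∧ j ∉ D).card

theorem weakSteps_zero {m : ℕ} (D : Finset (Fin m)) : weakSteps D 0 = 0 := by
  simp [weakSteps]

theorem weakSteps_last {m : ℕ} (D : Finset (Fin m)) :
    weakSteps D (Fin.last m) = m - D.card := by
  have : (Finset.univ.filter fun j : Fin m => j.castSucc < Fin.last m ∧ j ∉ D) = Dᶜ := by
    ext j; simp [Fin.castSucc_lt_last]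
  rw [weakSteps, this, Finset.card_compl, Fintype.card_fin]

theorem weakSteps_succ {m : ℕ} (D : Finset (Fin m)) (i : Fin m) :
    weakSteps D i.succ = weakSteps D i.castSucc + if i ∈ D then 0 else 1 := by
  unfold weakSteps
  split_ifs with h
  · rw [add_zero]
    congr 1
    ext j
    simp only [Finset.mem_filter, Finset.mem_univ, true_and, Fin.lt_def, Fin.val_castSucc,
      Fin.val_succ]
    constructor
    · rintro ⟨h1, h2⟩
      have : j ≠ i := fun h' => h2 (h' ▸ h)
      rw [Ne, Fin.ext_iff] at this
      exact ⟨by omega, h2⟩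
    · rintro ⟨h1, h2⟩
      exact ⟨by omega, h2⟩
  · rw [← Finset.card_insert_of_notMem (a := i) (by simp)]
    congr 1
    ext j
    simp only [Finset.mem_filter, Finset.mem_univ, true_and, Fin.lt_def, Fin.val_castSucc,
      Fin.val_succ, Finset.mem_insert, Fin.ext_iff]
    constructor
    · rintro ⟨h1, h2⟩
      by_cases hji : (j : ℕ) = i
      · exact Or.inl hji
      · exact Or.inr ⟨by omega, h2⟩
    · rintro (h1 | ⟨h1, h2⟩)
      · have : j = i := Fin.ext h1
        subst this
        exact ⟨by omega, h⟩
      · exact ⟨by omega, h2⟩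

theorem monotone_weakSteps {m : ℕ} (D : Finset (Fin m)) : Monotone (weakSteps D) :=
  Fin.monotone_iff_le_succ.2 fun i => by rw [weakSteps_succ]; omega

theorem card_orderEmbedding_fin (k n : ℕ) : Nat.card (Fin k ↪o Fin n) = n.choose k := by
  rw [Nat.card_congr (Set.powersetCard.ofFinEmbEquiv (I := Fin n) (n := k)),
    Set.powersetCard.card, Nat.card_fin]

/-- Adding the number of preceding weak steps turns monotone words that are strict at `D` into
strictly monotone words. -/
def monotoneStrictAtEquiv {m : ℕ} (D : Finset (Fin m)) (t : ℕ) :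
    {g : Fin (m + 1) → Fin (t + 1) //
      ∀ i : Fin m, g i.castSucc ≤ g i.succ ∧ (i ∈ D → g i.castSucc < g i.succ)} ≃
    (Fin (m + 1) ↪o Fin (t + 1 + (m - D.card))) where
  toFun g := OrderEmbedding.ofStrictMono
    (fun i => ⟨g.1 i + weakSteps D i, by
      have h1 := (g.1 i).2
      have h2 := monotone_weakSteps D (Fin.le_last i)
      rw [weakSteps_last] at h2
      omega⟩)
    (Fin.strictMono_iff_lt_succ.2 fun i => by
      obtain ⟨h1, h2⟩ := g.2 i
      simp only [Fin.mk_lt_mk, weakSteps_succ]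
      rw [Fin.le_def] at h1
      split_ifs with h
      · have := Fin.lt_def.1 (h2 h)
        omega
      · omega)
  invFun u :=
    have key : ∀ i : Fin m, (u i.castSucc : ℕ) + 1 ≤ u i.succ := fun i =>
      Fin.lt_def.1 (u.strictMono (Fin.castSucc_lt_succ))
    -- At each step `u` grows by at least one and `weakSteps D` by at most one. Starting from `u 0 ≥
    -- 0`, the difference stays nonnegative, so the truncated subtraction is exact.
    have mono : Monotone fun i => (u i : ℤ) - weakSteps D i :=
      Fin.monotone_iff_le_succ.2 fun i => by
        have := key i
        simp only [weakSteps_succ]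
        split_ifs <;> push_cast <;> omega
    ⟨fun i => ⟨u i - weakSteps D i, by
      have h := mono (Fin.le_last i)
      have h' := (u (Fin.last m)).2
      simp only [weakSteps_last] at h
      omega⟩, fun i => by
      have h := key i
      have h0 := mono (Fin.zero_le i.castSucc)
      simp only [weakSteps_zero] at h0
      simp only [Fin.mk_le_mk, Fin.mk_lt_mk, weakSteps_succ]
      refine ⟨by split_ifs <;> omega, fun hi => ?_⟩
      rw [if_pos hi]
      omega⟩
  left_inv g := by
    ext i
    simp
  right_inv u := by
    have key : ∀ i : Fin m, (u i.castSucc : ℕ) + 1 ≤ u i.succ := fun i =>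
      Fin.lt_def.1 (u.strictMono (Fin.castSucc_lt_succ))
    have mono : Monotone fun i => (u i : ℤ) - weakSteps D i :=
      Fin.monotone_iff_le_succ.2 fun i => by
        have := key i
        simp only [weakSteps_succ]
        split_ifs <;> push_cast <;> omega
    ext i
    have h0 := mono (Fin.zero_le i)
    simp only [weakSteps_zero] at h0
    simp
    omega

theorem card_monotoneStrictAt {m : ℕ} (D : Finset (Fin m)) (t : ℕ) :
    Nat.card {g : Fin (m + 1) → Fin (t + 1) //
      ∀ i : Fin m, g i.castSucc ≤ g i.succ ∧ (i ∈ D → g i.castSucc < g i.succ)} =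
    (t + 1 + (m - D.card)).choose (m + 1) := by
  rw [Nat.card_congr (monotoneStrictAtEquiv D t), card_orderEmbedding_fin]

/-- `Tuple.sort` breaks ties by index, so neighbours in sorted order may have equal values only
where `σ` ascends. -/
theorem sort_eq_iff_descentSet {m : ℕ} {α : Type*} [LinearOrder α] (f : Fin (m + 1) → α)
    (σ : Equiv.Perm (Fin (m + 1))) :
    Tuple.sort f = σ ↔ ∀ i : Fin m, f (σ i.castSucc) ≤ f (σ i.succ) ∧
      (i ∈ descentSet σ → f (σ i.castSucc) < f (σ i.succ)) := by
  have h : Tuple.sort f = σ ↔ StrictMono fun i => toLex (f (σ i), σ i) := by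
    rw [eq_comm, Tuple.eq_sort_iff']
    rfl
  rw [h, Fin.strictMono_iff_lt_succ]
  refine forall_congr' fun i => ?_
  have hne : σ i.castSucc ≠ σ i.succ := σ.injective.ne (Fin.castSucc_lt_succ).ne
  rw [Prod.Lex.toLex_lt_toLex]
  simp only [descentSet, Finset.mem_filter, Finset.mem_univ, true_and]
  constructor
  · rintro (h | ⟨h1, h2⟩)
    · exact ⟨h.le, fun _ => h⟩
    · exact ⟨h1.le, fun h3 => absurd h3 h2.not_gt⟩
  · rintro ⟨h1, h2⟩
    rcases h1.lt_or_eq with h | h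
    · exact Or.inl h
    · refine Or.inr ⟨h, lt_of_le_of_ne (not_lt.1 fun h3 => (h2 h3).ne h) hne⟩

theorem card_sort_eq {m : ℕ} (σ : Equiv.Perm (Fin (m + 1))) (t : ℕ) :
    Nat.card {f : Fin (m + 1) → Fin (t + 1) // Tuple.sort f = σ} =
      (t + 1 + (m - (descentSet σ).card)).choose (m + 1) := by
  rw [← card_monotoneStrictAt]
  refine Nat.card_congr (Equiv.subtypeEquiv (Equiv.arrowCongr σ.symm (Equiv.refl _)) fun f => ?_)
  rw [sort_eq_iff_descentSet]
  rfl

theorem card_sort_mem {m : ℕ} (S : Finset (Equiv.Perm (Fin (m + 1)))) (t : ℕ) :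
    Nat.card {f : Fin (m + 1) → Fin (t + 1) // Tuple.sort f ∈ S} =
      ∑ σ ∈ S, (t + 1 + (m - (descentSet σ).card)).choose (m + 1) := by
  classical
  rw [Nat.card_eq_fintype_card, Fintype.card_subtype,
    Finset.card_eq_sum_card_fiberwise (f := Tuple.sort) (t := S) (by intro f; simp)]
  refine Finset.sum_congr rfl fun σ hσ => ?_
  rw [← card_sort_eq, Nat.card_eq_fintype_card, Fintype.card_subtype, Finset.filter_filter]
  congr 1
  ext f
  simp only [Finset.mem_filter, Finset.mem_univ, true_and, and_iff_right_iff_imp]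
  exact fun h => h ▸ hσ

/-! ### Weak and strict order-preserving maps as sums over linear extensions -/

open Classical in
/-- The linear extensions of a relation `R` on `Fin (m + 1)`, as words. -/
noncomputable def linearExtensions {m : ℕ} (R : Fin (m + 1) → Fin (m + 1) → Prop) :
    Finset (Equiv.Perm (Fin (m + 1))) :=
  Finset.univ.filter fun σ => ∀ i j, R i j → σ.symm i < σ.symm j

theorem mem_linearExtensions {m : ℕ} {R : Fin (m + 1) → Fin (m + 1) → Prop}
    {σ : Equiv.Perm (Fin (m + 1))} :
    σ ∈ linearExtensions R ↔ ∀ i j, R i j → σ.symm i < σ.symm j := by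
  simp [linearExtensions]

/-- The sum of `X ^ des σ` over the linear extensions `σ` of `R`. -/
noncomputable def descentPolynomial {m : ℕ} (R : Fin (m + 1) → Fin (m + 1) → Prop) :
    Polynomial ℤ :=
  ∑ σ ∈ linearExtensions R, Polynomial.X ^ (descentSet σ).card

theorem card_descentSet_le {m : ℕ} (σ : Fin (m + 1) → Fin (m + 1)) :
    (descentSet σ).card ≤ m := by
  simpa using (descentSet σ).card_le_univ

theorem card_descentSet_rev {m : ℕ} (σ : Equiv.Perm (Fin (m + 1))) :
    (descentSet (σ.trans Fin.revPerm)).card = m - (descentSet σ).card := by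
  have : descentSet (σ.trans Fin.revPerm) = (descentSet σ)ᶜ := by
    ext i
    have hne : σ i.castSucc ≠ σ i.succ := σ.injective.ne (Fin.castSucc_lt_succ).ne
    simp only [descentSet, Equiv.trans_apply, Fin.revPerm_apply, Fin.rev_lt_rev,
      Finset.mem_filter, Finset.mem_univ, true_and, Finset.mem_compl, not_lt]
    exact ⟨le_of_lt, fun h => lt_of_le_of_ne h hne⟩
  rw [this, Finset.card_compl, Fintype.card_fin]

/-- The number of weakly order-preserving maps into a chain with `t + 1` elements. -/
noncomputable def weakCount {m : ℕ} (R : Fin (m + 1) → Fin (m + 1) → Prop) (t : ℕ) : ℕ :=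
  Nat.card {f : Fin (m + 1) → Fin (t + 1) // ∀ i j, R i j → f i ≤ f j}

/-- The number of strictly order-preserving maps into a chain with `t + 1` elements. -/
noncomputable def strictCount {m : ℕ} (R : Fin (m + 1) → Fin (m + 1) → Prop) (t : ℕ) : ℕ :=
  Nat.card {f : Fin (m + 1) → Fin (t + 1) // ∀ i j, R i j → f i < f j}

theorem sort_symm_lt_iff {n : ℕ} {α : Type*} [LinearOrder α] (f : Fin n → α) (i j : Fin n) :
    (Tuple.sort f).symm i < (Tuple.sort f).symm j ↔ f i < f j ∨ f i = f j ∧ i < j := by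
  have h := (Tuple.eq_sort_iff' (f := f)).1 rfl
  have h2 := h.lt_iff_lt (a := (Tuple.sort f).symm i) (b := (Tuple.sort f).symm j)
  rw [← h2]
  simp only [Equiv.trans_apply, Equiv.apply_symm_apply]
  exact Prod.Lex.toLex_lt_toLex

/-- Since `R i j` implies `i < j`, a tie between `f i` and `f j` is sorted in the order that `R`
demands. -/
theorem weakCount_eq_sum {m : ℕ} {R : Fin (m + 1) → Fin (m + 1) → Prop}
    (hR : ∀ i j, R i j → i < j) (t : ℕ) :
    weakCount R t =
      ∑ σ ∈ linearExtensions R, (t + 1 + (m - (descentSet σ).card)).choose (m + 1) := by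
  rw [← card_sort_mem, weakCount]
  refine Nat.card_congr (Equiv.subtypeEquivRight fun f => ?_)
  rw [mem_linearExtensions]
  refine forall_congr' fun i => forall_congr' fun j => imp_congr_right fun h => ?_
  rw [sort_symm_lt_iff, le_iff_lt_or_eq]
  simp [hR i j h]

/-- Reversing the labels makes every tie along `R` sort the wrong way, so lying over a linear
extension now forces strict inequality. The reversal complements descent sets. -/
theorem strictCount_eq_sum {m : ℕ} {R : Fin (m + 1) → Fin (m + 1) → Prop}
    (hR : ∀ i j, R i j → i < j) (t : ℕ) :
    strictCount R t =
      ∑ σ ∈ linearExtensions R, (t + 1 + (descentSet σ).card).choose (m + 1) := by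
  have hsum : ∑ σ ∈ linearExtensions R, (t + 1 + (descentSet σ).card).choose (m + 1) =
      ∑ τ ∈ linearExtensions fun i j => R i.rev j.rev,
        (t + 1 + (m - (descentSet τ).card)).choose (m + 1) := by
    refine Finset.sum_bij' (fun σ _ => σ.trans Fin.revPerm) (fun σ _ => σ.trans Fin.revPerm)
      ?_ ?_ ?_ ?_ ?_
    · intro σ hσ
      rw [mem_linearExtensions] at hσ ⊢
      intro i j h
      exact hσ _ _ h
    · intro σ hσ
      rw [mem_linearExtensions] at hσ ⊢
      intro i j h
      exact hσ i.rev j.rev (by simpa using h)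
    · intro σ _
      ext i
      simp
    · intro σ _
      ext i
      simp
    · intro σ _
      rw [card_descentSet_rev]
      have := card_descentSet_le σ
      congr 2
      omega
  rw [hsum, ← card_sort_mem, strictCount]
  refine Nat.card_congr (Equiv.subtypeEquiv (Equiv.arrowCongr Fin.revPerm (Equiv.refl _))
    fun f => ?_)
  rw [mem_linearExtensions]
  constructor
  · intro h i j hij
    rw [sort_symm_lt_iff]
    exact Or.inl (h _ _ hij)
  · intro h i j hij
    have := h i.rev j.rev (by simpa using hij)
    rw [sort_symm_lt_iff] at this
    rcases this with h1 | ⟨-, h1⟩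
    · simpa using h1
    · exact absurd (hR i j hij) (Fin.rev_lt_rev.1 h1).not_gt

/-! ### Generating series and their numerators -/

theorem mk_choose_mul_one_sub_pow (m s : ℕ) (hs : s ≤ m) :
    (PowerSeries.mk fun t => ((t + 1 + (m - s)).choose (m + 1) : ℤ)) *
      (1 - PowerSeries.X) ^ (m + 2) = PowerSeries.X ^ s := by
  have h : (PowerSeries.mk fun t => ((t + 1 + (m - s)).choose (m + 1) : ℤ)) =
      PowerSeries.X ^ s * PowerSeries.mk fun t => ((m + 1 + t).choose (m + 1) : ℤ) := by
    ext t
    rw [PowerSeries.coeff_X_pow_mul', PowerSeries.coeff_mk]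
    split_ifs with h
    · rw [PowerSeries.coeff_mk]
      congr 2
      omega
    · rw [Nat.choose_eq_zero_of_lt (by omega), Nat.cast_zero]
  rw [h, mul_assoc, PowerSeries.mk_add_choose_mul_one_sub_pow_eq_one, mul_one]

theorem mk_sum_choose_mul_one_sub_pow {ι : Type*} (S : Finset ι) (m : ℕ) (s : ι → ℕ)
    (hs : ∀ i, s i ≤ m) :
    (PowerSeries.mk fun t => ((∑ i ∈ S, (t + 1 + (m - s i)).choose (m + 1) : ℕ) : ℤ)) *
      (1 - PowerSeries.X) ^ (m + 2) =
    ((∑ i ∈ S, Polynomial.X ^ s i : Polynomial ℤ) : PowerSeries ℤ) := by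
  have h : (PowerSeries.mk fun t => ((∑ i ∈ S, (t + 1 + (m - s i)).choose (m + 1) : ℕ) : ℤ)) =
      ∑ i ∈ S, PowerSeries.mk fun t => ((t + 1 + (m - s i)).choose (m + 1) : ℤ) := by
    ext t
    simp
  rw [h, Finset.sum_mul, ← Polynomial.coeToPowerSeries.ringHom_apply, map_sum]
  refine Finset.sum_congr rfl fun i _ => ?_
  rw [mk_choose_mul_one_sub_pow m _ (hs i)]
  simp

theorem mk_weakCount_mul {m : ℕ} {R : Fin (m + 1) → Fin (m + 1) → Prop}
    (hR : ∀ i j, R i j → i < j) :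
    (PowerSeries.mk fun t => (weakCount R t : ℤ)) * (1 - PowerSeries.X) ^ (m + 2) =
      (descentPolynomial R : PowerSeries ℤ) := by
  simp only [weakCount_eq_sum hR]
  exact mk_sum_choose_mul_one_sub_pow _ _ _ fun σ : Equiv.Perm _ => card_descentSet_le σ

theorem reflect_descentPolynomial {m : ℕ} (R : Fin (m + 1) → Fin (m + 1) → Prop) :
    Polynomial.reflect m (descentPolynomial R) =
      ∑ σ ∈ linearExtensions R, Polynomial.X ^ (m - (descentSet σ).card) := by
  ext k
  simp only [descentPolynomial, Polynomial.coeff_reflect, Polynomial.finsetSum_coeff]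
  refine Finset.sum_congr rfl fun σ _ => ?_
  rw [← Polynomial.coeff_reflect, Polynomial.reflect_monomial,
    Polynomial.revAt_le (card_descentSet_le σ)]

theorem mk_strictCount_mul {m : ℕ} {R : Fin (m + 1) → Fin (m + 1) → Prop}
    (hR : ∀ i j, R i j → i < j) :
    (PowerSeries.mk fun t => (strictCount R t : ℤ)) * (1 - PowerSeries.X) ^ (m + 2) =
      (Polynomial.reflect m (descentPolynomial R) : PowerSeries ℤ) := by
  rw [reflect_descentPolynomial, ← mk_sum_choose_mul_one_sub_pow _ m _ fun _ => Nat.sub_le _ _]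
  simp only [strictCount_eq_sum hR, Nat.sub_sub_self (card_descentSet_le _)]

theorem weakCount_zero {m : ℕ} (R : Fin (m + 1) → Fin (m + 1) → Prop) : weakCount R 0 = 1 := by
  have : Subsingleton (Fin (0 + 1)) := inferInstanceAs (Subsingleton (Fin 1))
  rw [weakCount, Nat.card_eq_one_iff_unique]
  exact ⟨inferInstance, ⟨⟨fun _ => 0, fun _ _ _ => le_rfl⟩⟩⟩

theorem strictCount_zero {m : ℕ} {R : Fin (m + 1) → Fin (m + 1) → Prop} (hR : ∃ i j, R i j) :
    strictCount R 0 = 0 := by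
  obtain ⟨i, j, hij⟩ := hR
  have : Subsingleton (Fin (0 + 1)) := inferInstanceAs (Subsingleton (Fin 1))
  have : IsEmpty {f : Fin (m + 1) → Fin (0 + 1) // ∀ i j, R i j → f i < f j} :=
    ⟨fun f => (f.2 i j hij).ne (Subsingleton.elim _ _)⟩
  exact Nat.card_of_isEmpty

/-! ### Reciprocity and palindromicity -/

/-- If `R` is a relation from its set of sources to its set of targets and every element is a
source or a target, then raising the targets by one turns weakly order-preserving maps into
strictly order-preserving ones. -/
theorem strictCount_succ {m : ℕ} {R : Fin (m + 1) → Fin (m + 1) → Prop} (c : Fin (m + 1) → Bool)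
    (hc : ∀ i j, R i j → c i = false ∧ c j = true) (h0 : ∀ i, c i = false → ∃ j, R i j)
    (h1 : ∀ j, c j = true → ∃ i, R i j) (t : ℕ) : strictCount R (t + 1) = weakCount R t := by
  symm
  refine Nat.card_congr
    { toFun f := ⟨fun i => ⟨f.1 i + (c i).toNat, ?_⟩, ?_⟩
      invFun f := ⟨fun i => ⟨f.1 i - (c i).toNat, ?_⟩, ?_⟩
      left_inv f := ?_
      right_inv f := ?_ }
  · have := (f.1 i).2
    have := (c i).toNat_le
    omega
  · intro i j hij
    have h := Fin.le_def.1 (f.2 i j hij)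
    obtain ⟨hi, hj⟩ := hc i j hij
    simp only [Fin.mk_lt_mk, hi, hj, Bool.toNat_false, Bool.toNat_true]
    omega
  · have := (f.1 i).2
    cases hi : c i
    -- A source lies strictly below some target, so its value is not the top of the longer chain.
    · obtain ⟨j, hj⟩ := h0 i hi
      have h := Fin.lt_def.1 (f.2 i j hj)
      have := (f.1 j).2
      simp only [Bool.toNat_false]
      omega
    · simp only [Bool.toNat_true]
      omega
  · intro i j hij
    have h := Fin.lt_def.1 (f.2 i j hij)
    obtain ⟨hi, hj⟩ := hc i j hij
    simp only [Fin.mk_le_mk, hi, hj, Bool.toNat_false, Bool.toNat_true]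
    omega
  · ext i
    simp
  · ext i
    cases hi : c i
    · simp [hi]
    -- A target lies strictly above some source, so its value is positive and subtracting one is not
    -- truncated.
    · obtain ⟨j, hj⟩ := h1 i hi
      have h := Fin.lt_def.1 (f.2 j i hj)
      simp only [hi, Bool.toNat_true]
      omega

theorem reflect_descentPolynomial_eq_X_mul {m : ℕ} {R : Fin (m + 1) → Fin (m + 1) → Prop}
    (hR : ∀ i j, R i j → i < j) (h0 : strictCount R 0 = 0)
    (hs : ∀ t, strictCount R (t + 1) = weakCount R t) :
    Polynomial.reflect m (descentPolynomial R) = Polynomial.X * descentPolynomial R := by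
  have h : (PowerSeries.mk fun t => (strictCount R t : ℤ)) =
      PowerSeries.X * PowerSeries.mk fun t => (weakCount R t : ℤ) := by
    ext t
    cases t with
    | zero => simp [h0]
    | succ t => rw [PowerSeries.coeff_succ_X_mul, PowerSeries.coeff_mk, PowerSeries.coeff_mk, hs]
  refine Polynomial.coe_injective ℤ ?_
  rw [← mk_strictCount_mul hR, Polynomial.coe_mul, Polynomial.coe_X, ← mk_weakCount_mul hR, h,
    mul_assoc]

theorem coeff_zero_descentPolynomial {m : ℕ} {R : Fin (m + 1) → Fin (m + 1) → Prop}
    (hR : ∀ i j, R i j → i < j) : (descentPolynomial R).coeff 0 = 1 := by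
  have h := congrArg (PowerSeries.coeff 0) (mk_weakCount_mul hR)
  rw [Polynomial.coeff_coe] at h
  rw [← h]
  simp [weakCount_zero]

theorem natDegree_descentPolynomial_le {m : ℕ} (R : Fin (m + 1) → Fin (m + 1) → Prop) :
    (descentPolynomial R).natDegree ≤ m := by
  refine Polynomial.natDegree_sum_le_of_forall_le _ _ fun σ _ => ?_
  rw [Polynomial.natDegree_X_pow]
  exact card_descentSet_le σ

/-- Coefficient 0 of the identity kills the coefficient of `p` at `n + 1`; coefficient `k + 1`
equates those at `n - k` and `k`. -/
theorem isPalindromicOfDegree_of_reflect_succ {n : ℕ} {p : Polynomial ℤ}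
    (hp : p.natDegree ≤ n + 1) (h0 : p.coeff 0 ≠ 0)
    (h : Polynomial.reflect (n + 1) p = Polynomial.X * p) : IsPalindromicOfDegree p n := by
  have hk : ∀ k, (Polynomial.reflect (n + 1) p).coeff (k + 1) = p.coeff k := fun k => by
    rw [h, Polynomial.coeff_X_mul]
  have htop : p.coeff (n + 1) = 0 := by
    have := congrArg (fun q => Polynomial.coeff q 0) h
    simpa [Polynomial.coeff_reflect, Polynomial.revAt_le] using this
  have hrefl : Polynomial.reflect n p = p := by
    ext k
    rw [Polynomial.coeff_reflect]
    rcases le_or_gt k n with hkn | hkn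
    · rw [← hk k, Polynomial.coeff_reflect, Polynomial.revAt_le hkn,
        Polynomial.revAt_le (by omega)]
      congr 1
      omega
    · rw [Polynomial.revAt_eq_self_of_lt hkn]
  have hn : p.coeff n = p.coeff 0 := by
    conv_rhs => rw [← hrefl]
    rw [Polynomial.coeff_reflect, Polynomial.revAt_zero]
  refine ⟨le_antisymm ?_ (Polynomial.le_degree_of_ne_zero (hn ▸ h0)), hrefl⟩
  rw [Polynomial.degree_le_iff_coeff_zero]
  intro k hkn
  rw [Nat.cast_lt] at hkn
  rcases Nat.lt_or_ge (n + 1) k with h' | h'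
  · exact Polynomial.coeff_eq_zero_of_natDegree_lt (by omega)
  · obtain rfl : k = n + 1 := by omega
    exact htop

/-! ### Lattice points of graph polytopes of bipartite graphs -/

open scoped Pointwise in
theorem intCast_mem_smul_graphPolytope_iff {V : Type*} (G : SimpleGraph V) {t : ℕ} (ht : t ≠ 0)
    (m : V → ℤ) :
    ((fun v => (m v : ℝ)) ∈ (t : ℝ) • graphPolytope G) ↔
      (∀ v, 0 ≤ m v ∧ m v ≤ t) ∧ ∀ v w, G.Adj v w → m v + m w ≤ t := by
  have ht' : (0 : ℝ) < t := by positivity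
  rw [Set.mem_smul_set_iff_inv_smul_mem₀ ht'.ne']
  simp only [graphPolytope, Set.mem_ofPred_eq, Pi.smul_apply, smul_eq_mul, Set.mem_Icc]
  refine and_congr (forall_congr' fun v => and_congr ?_ ?_)
    (forall_congr' fun v => forall_congr' fun w => imp_congr_right fun _ => ?_)
  · rw [mul_nonneg_iff_of_pos_left (inv_pos.2 ht')]
    exact Int.cast_nonneg_iff
  · rw [inv_mul_le_one₀ ht']
    exact_mod_cast Iff.rfl
  · rw [← mul_add, inv_mul_le_one₀ ht']
    exact_mod_cast Iff.rfl

/-- Reflecting the coordinates in the second colour class, the lattice points of a dilated graph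
polytope of a bipartite graph become weakly order-preserving maps. -/
theorem latticeCount_graphPolytope {V : Type*} {m : ℕ} (G : SimpleGraph V)
    (e : V ≃ Fin (m + 1)) (c : Fin (m + 1) → Bool) (hc : Monotone c)
    (hG : ∀ v w, G.Adj v w → c (e v) ≠ c (e w)) {t : ℕ} (ht : t ≠ 0) :
    latticeCount (graphPolytope G) t =
      weakCount (fun i j => i < j ∧ G.Adj (e.symm i) (e.symm j)) t := by
  rw [latticeCount, ← Nat.card_coe_set_eq]
  have hcol : ∀ i j, i < j ∧ G.Adj (e.symm i) (e.symm j) → c i = false ∧ c j = true := by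
    rintro i j ⟨hij, h⟩
    have h1 := hc hij.le
    have h2 := hG _ _ h
    rw [Equiv.apply_symm_apply, Equiv.apply_symm_apply] at h2
    revert h1 h2
    cases c i <;> cases c j <;> simp
  refine Nat.card_congr
    { toFun x := ⟨fun i => ⟨(if c i then t - x.1 (e.symm i) else x.1 (e.symm i)).toNat, ?_⟩, ?_⟩
      invFun f := ⟨fun v => if c (e v) then t - (f.1 (e v) : ℤ) else (f.1 (e v) : ℤ), ?_⟩
      left_inv x := ?_
      right_inv f := ?_ }
  · obtain ⟨h1, -⟩ := (intCast_mem_smul_graphPolytope_iff G ht _).1 x.2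
    have := h1 (e.symm i)
    split_ifs <;> omega
  · obtain ⟨h1, h2⟩ := (intCast_mem_smul_graphPolytope_iff G ht _).1 x.2
    intro i j hij
    have h := h2 _ _ hij.2
    have := h1 (e.symm i)
    obtain ⟨hi, hj⟩ := hcol i j hij
    simp only [Fin.mk_le_mk, hi, hj, if_true, Bool.false_eq_true, if_false]
    omega
  · refine (intCast_mem_smul_graphPolytope_iff G ht _).2 ⟨fun v => ?_, fun v w h => ?_⟩
    · have := (f.1 (e v)).2
      split_ifs <;> omega
    · have hne := e.injective.ne h.ne
      rcases hne.lt_or_gt with hlt | hlt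
      · have hR : e v < e w ∧ G.Adj (e.symm (e v)) (e.symm (e w)) := ⟨hlt, by simpa using h⟩
        obtain ⟨hi, hj⟩ := hcol _ _ hR
        have := Fin.le_def.1 (f.2 _ _ hR)
        simp only [hi, hj, if_true, Bool.false_eq_true, if_false]
        omega
      · have hR : e w < e v ∧ G.Adj (e.symm (e w)) (e.symm (e v)) :=
          ⟨hlt, by simpa using h.symm⟩
        obtain ⟨hi, hj⟩ := hcol _ _ hR
        have := Fin.le_def.1 (f.2 _ _ hR)
        simp only [hi, hj, if_true, Bool.false_eq_true, if_false]
        omega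
  · obtain ⟨h1, -⟩ := (intCast_mem_smul_graphPolytope_iff G ht _).1 x.2
    ext v
    have := h1 v
    simp only [Equiv.symm_apply_apply]
    split_ifs <;> omega
  · ext i
    have := (f.1 i).2
    simp only [Equiv.apply_symm_apply]
    split_ifs <;> omega

/-- Numbering the vertices by colour orients every edge from the first class to the second, so that
the relation increases along the labels. -/
theorem exists_equiv_fin_monotone {V α : Type*} [Fintype V] [LinearOrder α] {n : ℕ}
    (hn : Fintype.card V = n) (c : V → α) : ∃ e : V ≃ Fin n, Monotone (c ∘ e.symm) := by
  let e₀ := Fintype.equivFinOfCardEq hn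
  exact ⟨e₀.trans (Tuple.sort (c ∘ e₀.symm)).symm, Tuple.monotone_sort (c ∘ e₀.symm)⟩

theorem isHStarPolynomial_descentPolynomial {V : Type*} [Fintype V] {m : ℕ} (G : SimpleGraph V)
    (e : V ≃ Fin (m + 1)) (c : Fin (m + 1) → Bool) (hc : Monotone c)
    (hG : ∀ v w, G.Adj v w → c (e v) ≠ c (e w)) :
    IsHStarPolynomial (graphPolytope G)
      (descentPolynomial fun i j => i < j ∧ G.Adj (e.symm i) (e.symm j)) := by
  have hcard : Fintype.card V = m + 1 := by simpa using Fintype.card_congr e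
  rw [IsHStarPolynomial, hcard, ← mk_weakCount_mul fun _ _ h => h.1]
  congr 1
  ext t
  simp only [ehrhartSeries, PowerSeries.coeff_mk]
  split_ifs with ht
  · rw [ht, weakCount_zero, Nat.cast_one]
  · rw [latticeCount_graphPolytope G e c hc hG ht]

theorem exists_palindromic_isHStarPolynomial_of_isBipartite {V : Type*} [Fintype V] [Nonempty V]
    (G : SimpleGraph V) (hG : G.IsBipartite) (hiso : ∀ v, ∃ w, G.Adj v w) :
    ∃ h : Polynomial ℤ, IsHStarPolynomial (graphPolytope G) h ∧
      IsPalindromicOfDegree h (Fintype.card V - 2) := by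
  obtain ⟨v₀⟩ := ‹Nonempty V›
  obtain ⟨w₀, h₀⟩ := hiso v₀
  have : Nontrivial V := ⟨v₀, w₀, h₀.ne⟩
  obtain ⟨n, hn⟩ := Nat.exists_eq_add_of_le' (Fintype.one_lt_card (α := V))
  replace hn : Fintype.card V = n + 1 + 1 := hn
  obtain ⟨C⟩ := hG
  let b : V → Bool := fun v => decide (C v = 1)
  obtain ⟨e, he⟩ := exists_equiv_fin_monotone hn b
  have hb : ∀ v w, G.Adj v w → b v ≠ b w := by
    intro v w h h'
    have := C.valid h
    simp only [b, decide_eq_decide] at h'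
    omega
  have hR : ∀ i j, i < j ∧ G.Adj (e.symm i) (e.symm j) →
      (b ∘ e.symm) i = false ∧ (b ∘ e.symm) j = true := by
    rintro i j ⟨hij, h⟩
    have h1 := he hij.le
    have h2 := hb _ _ h
    revert h1 h2
    simp only [Function.comp_apply]
    cases b (e.symm i) <;> cases b (e.symm j) <;> simp
  have hlt : ∀ i j, G.Adj (e.symm i) (e.symm j) → (b ∘ e.symm) i = false → i < j := by
    intro i j h hi
    have h2 := hb _ _ h
    refine he.reflect_lt ?_
    rw [hi]
    simp only [Function.comp_apply] at hi ⊢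
    rw [hi] at h2
    cases hj : b (e.symm j)
    · exact absurd hj.symm h2
    · exact rfl
  have hs : ∀ t, strictCount (fun i j => i < j ∧ G.Adj (e.symm i) (e.symm j)) (t + 1) =
      weakCount (fun i j => i < j ∧ G.Adj (e.symm i) (e.symm j)) t := by
    refine strictCount_succ (b ∘ e.symm) hR (fun i hi => ?_) (fun j hj => ?_)
    · obtain ⟨w, hw⟩ := hiso (e.symm i)
      rw [← e.symm_apply_apply w] at hw
      exact ⟨e w, hlt _ _ hw hi, hw⟩
    · obtain ⟨w, hw⟩ := hiso (e.symm j)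
      have h2 := hb _ _ hw
      rw [← e.symm_apply_apply w] at hw
      refine ⟨e w, hlt _ _ hw.symm ?_, hw.symm⟩
      simp only [Function.comp_apply] at hj ⊢
      rw [hj] at h2
      rw [e.symm_apply_apply]
      exact Bool.eq_false_iff.2 h2.symm
  have hex : ∃ i j, i < j ∧ G.Adj (e.symm i) (e.symm j) := by
    have h : G.Adj (e.symm (e v₀)) (e.symm (e w₀)) := by simpa using h₀
    rcases (e.injective.ne h₀.ne).lt_or_gt with hl | hl
    · exact ⟨_, _, hl, h⟩
    · exact ⟨_, _, hl, h.symm⟩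
  have hlt' : ∀ i j, i < j ∧ G.Adj (e.symm i) (e.symm j) → i < j := fun _ _ h => h.1
  refine ⟨_, isHStarPolynomial_descentPolynomial G e (b ∘ e.symm) he
    (fun v w h => by simpa using hb v w h), ?_⟩
  rw [hn, show n + 1 + 1 - 2 = n from rfl]
  refine isPalindromicOfDegree_of_reflect_succ (natDegree_descentPolynomial_le _) ?_
    (reflect_descentPolynomial_eq_X_mul hlt' (strictCount_zero hex) hs)
  rw [coeff_zero_descentPolynomial hlt']
  exact one_ne_zero

/-! ### Small cases and path graphs -/

theorem isPalindromicOfDegree_one : IsPalindromicOfDegree 1 0 :=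
  ⟨by simp, by simp⟩

open scoped Pointwise in
theorem isHStarPolynomial_graphPolytope_of_isEmpty {V : Type*} [Fintype V] [IsEmpty V]
    (G : SimpleGraph V) : IsHStarPolynomial (graphPolytope G) 1 := by
  have h : ehrhartSeries (graphPolytope G) = PowerSeries.mk 1 := by
    ext t
    simp only [ehrhartSeries, PowerSeries.coeff_mk, Pi.one_apply]
    split_ifs with ht
    · rfl
    · have : {m : V → ℤ | (fun v => (m v : ℝ)) ∈ (t : ℝ) • graphPolytope G} = Set.univ := by
        ext m
        simp [intCast_mem_smul_graphPolytope_iff G ht]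
      rw [latticeCount, this, Set.ncard_univ, Nat.card_unique, Nat.cast_one]
  rw [IsHStarPolynomial, h, Fintype.card_eq_zero, zero_add, pow_one,
    PowerSeries.mk_one_mul_one_sub_eq_one, Polynomial.coe_one]

theorem isHStarPolynomial_graphPolytope_fin_one (G : SimpleGraph (Fin 1)) :
    IsHStarPolynomial (graphPolytope G) 1 := by
  have h := isHStarPolynomial_descentPolynomial G (Equiv.refl _) (fun _ => false)
    monotone_const fun v w h => absurd (Subsingleton.elim v w) h.ne
  convert h
  have hd := Polynomial.eq_C_of_natDegree_le_zero (natDegree_descentPolynomial_le (m := 0)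
    fun i j => i < j ∧ G.Adj ((Equiv.refl (Fin 1)).symm i) ((Equiv.refl (Fin 1)).symm j))
  rw [hd, coeff_zero_descentPolynomial fun _ _ h => h.1, Polynomial.C_1]

theorem exists_adj_pathGraph {n : ℕ} (hn : 2 ≤ n) (v : Fin n) :
    ∃ w, (SimpleGraph.pathGraph n).Adj v w := by
  simp only [SimpleGraph.pathGraph_adj]
  by_cases h : (v : ℕ) + 1 < n
  · exact ⟨⟨v + 1, h⟩, Or.inl rfl⟩
  · exact ⟨⟨v - 1, by omega⟩, Or.inr (by simp only; omega)⟩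

theorem mainTheorem1 :
    (∀ (V : Type*) [Fintype V] [Nonempty V] (G : SimpleGraph V),
      G.IsBipartite → (∀ v, ∃ w, G.Adj v w) →
        ∃ h : Polynomial ℤ, IsHStarPolynomial (graphPolytope G) h ∧
          IsPalindromicOfDegree h (Fintype.card V - 2)) ∧
    (∀ n : ℕ, ∃ h : Polynomial ℤ,
      IsHStarPolynomial (graphPolytope (SimpleGraph.pathGraph n)) h ∧
        IsPalindromicOfDegree h (n - 2)) := by
  refine ⟨fun V _ _ G hG hiso =>
    exists_palindromic_isHStarPolynomial_of_isBipartite G hG hiso, fun n => ?_⟩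
  match n with
  -- Part (a) excludes the empty graph and the isolated vertex; here the truncated `n - 2` is the
  -- required degree 0.
  | 0 => exact ⟨1, isHStarPolynomial_graphPolytope_of_isEmpty _, isPalindromicOfDegree_one⟩
  | 1 => exact ⟨1, isHStarPolynomial_graphPolytope_fin_one _, isPalindromicOfDegree_one⟩
  | n + 2 =>
    have h := exists_palindromic_isHStarPolynomial_of_isBipartite (SimpleGraph.pathGraph (n + 2))
      (SimpleGraph.pathGraph.bicoloring (n + 2)).colorable
      (exists_adj_pathGraph (Nat.le_add_left 2 n))
    rwa [Fintype.card_fin] at h
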